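/- Let $q$ be an odd prime power and let $m,n$ be integers with $0<n<4m$, $\gcd(m,n)=1$, $\frac{2m}{\gcd(2m,n)}$ odd and $q^m\equiv q^n\equiv 1 \pmod 4$. Let $u$ be a primitive element of $\mathbb F_{q^{4m}}$, put $v=u^{q^m-1}$, and let $\mathbb B=(\mathbb F_{q^{4m}},+,\star)$ be the Bierbrauer presemifield with multiplication $$x\star y=y^{q^n}x+yx^{q^n}-v\bigl(y^{q^{m+n}}x^{q^{3m}}+y^{q^{3m}}x^{q^{m+n}}\bigr).$$ Then $\mathbb B$ is indeed a presemifield (its multiplication is distributive and has no zero divisors), and: 1. The middle nucleus of $\mathbb B$, that is, the largest field $\mathcal N$ of additive endomorphisms of $\mathbb F_{q^{4m}}$ such that $\mathcal C\mathcal N\subseteq\mathcal C$, where $\mathcal C=\{x\mapsto x\star y : y\in\mathbb F_{q^{4m}}\}$, is exactly the field of scalar maps $\{x\mapsto\lambda x:\lambda\in\mathbb F_{q^2}\}$, of order $q^2$. 2. $\mathbb B$ has middle nucleus of order $q^2$ and center of order $q$; that is, every semifield $(S,+,\bullet)$ isotopic to $\mathbb B$ has middle nucleus $\{b\in S: (a\bullet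 b)\bullet c=a\bullet(b\bullet c)\ \forall a,c\in S\}$ of order $q^2$ and center of order $q$, the center being the set of all elements of $S$ that lie in the left, middle and right nuclei and commute with every element of $S$. -/

import Mathlib

section Presemifields

variable {S : Type*} [AddCommGroup S]

/-- A finite presemifield `(S, +, mul)`: a non-trivial finite abelian group with a distributive
multiplication without zero divisors. -/
structure IsPresemifield (mul : S → S → S) : Prop where
  finite : Finite S
  nontrivial : Nontrivial S
  left_distrib : ∀ a b c : S, mul a (b + c) = mul a b + mul a c
  right_distrib : ∀ a b c : S, mul (a + b) c = mul a c + mul b c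
  eq_zero_or_eq_zero : ∀ a b : S, mul a b = 0 → a = 0 ∨ b = 0

/-- A finite semifield: a finite presemifield with a two-sided multiplicative identity. -/
structure IsSemifield (mul : S → S → S) : Prop extends IsPresemifield mul where
  exists_one : ∃ e : S, ∀ x : S, mul e x = x ∧ mul x e = x

/-- The left nucleus. -/
def leftNucleus (mul : S → S → S) : Set S :=
  {a | ∀ b c, mul (mul a b) c = mul a (mul b c)}

/-- The middle nucleus. -/
def middleNucleus (mul : S → S → S) : Set S :=
  {b | ∀ a c, mul (mul a b) c = mul a (mul b c)}

/-- The right nucleus. -/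
def rightNucleus (mul : S → S → S) : Set S :=
  {c | ∀ a b, mul (mul a b) c = mul a (mul b c)}

/-- The center. -/
def semifieldCenter (mul : S → S → S) : Set S :=
  {a | a ∈ leftNucleus mul ∩ middleNucleus mul ∩ rightNucleus mul ∧ ∀ b, mul a b = mul b a}

/-- Isotopy. For groups of prime exponent `p`, additive bijections are the same as invertible
`𝔽_p`-linear maps. -/
def Isotopic {S' : Type*} [AddCommGroup S'] (mul : S → S → S) (mul' : S' → S' → S') : Prop :=
  ∃ g₁ g₂ g₃ : S ≃+ S', ∀ x y : S, mul' (g₁ x) (g₂ y) = g₃ (mul x y)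

/-- The spread set `{φ_y : x ↦ x ⋆ y}`, inside the ring of additive (i.e. `𝔽_p`-linear)
endomorphisms of `S`. -/
def spreadSet (mul : S → S → S) : Set (AddMonoid.End S) :=
  {φ | ∃ y : S, ∀ x : S, φ x = mul x y}

/-- `N` is the middle nucleus of the presemifield `(S, +, mul)`: the largest field of additive
endomorphisms of `S` such that `C N ⊆ C`, where `C` is the spread set. -/
def IsPresemifieldMiddleNucleus (mul : S → S → S) (N : Subring (AddMonoid.End S)) : Prop :=
  IsGreatest {K : Subring (AddMonoid.End S) |
    IsField K ∧ ∀ φ ∈ spreadSet mul, ∀ μ ∈ K, φ * μ ∈ spreadSet mul} N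

/-- Every finite presemifield is isotopic to a semifield, so that speaking of the parameters of the
semifields isotopic to it is never vacuous. -/
theorem IsPresemifield.exists_isotopic_semifield {mul : S → S → S} (h : IsPresemifield mul) :
    ∃ mul' : S → S → S, IsSemifield mul' ∧ Isotopic mul mul' := by
  have := h.finite
  have := h.nontrivial
  obtain ⟨e, he⟩ := exists_ne (0 : S)
  let R : S →+ S := AddMonoidHom.mk' (fun x => mul x e) (fun a b => h.right_distrib a b e)
  let L : S →+ S := AddMonoidHom.mk' (fun y => mul e y) (fun a b => h.left_distrib e a b)
  have hR : Function.Bijective R := Finite.injective_iff_bijective.1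
    ((injective_iff_map_eq_zero R).2 fun a ha =>
      (h.eq_zero_or_eq_zero a e ha).resolve_right he)
  have hL : Function.Bijective L := Finite.injective_iff_bijective.1
    ((injective_iff_map_eq_zero L).2 fun a ha =>
      (h.eq_zero_or_eq_zero e a ha).resolve_left he)
  let r : S ≃+ S := AddEquiv.ofBijective R hR
  let l : S ≃+ S := AddEquiv.ofBijective L hL
  have hr : r e = mul e e := rfl
  have hl : l e = mul e e := rfl
  refine ⟨fun x y => mul (r.symm x) (l.symm y), ⟨⟨h.finite, h.nontrivial, ?_, ?_, ?_⟩, ?_⟩, ?_⟩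
  · intro a b c
    simp [h.left_distrib]
  · intro a b c
    simp [h.right_distrib]
  · intro a b hab
    simpa using h.eq_zero_or_eq_zero _ _ hab
  · refine ⟨mul e e, fun x => ⟨?_, ?_⟩⟩
    · simp only [← hr, AddEquiv.symm_apply_apply]
      exact l.apply_symm_apply x
    · simp only [← hl, AddEquiv.symm_apply_apply]
      exact r.apply_symm_apply x
  · exact ⟨r, l, AddEquiv.refl S, fun x y => by simp⟩

end Presemifields

/-- The field of scalar maps `x ↦ λ x`, `λ ∈ L`, as a ring of additive endomorphisms of `F`. -/
def scalarMaps {F : Type*} [Field F] (L : Subfield F) : Subring (AddMonoid.End F) :=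
  L.toSubring.map (Module.toAddMonoidEnd F F)

/-- The Bierbrauer multiplication with coefficient `v`. -/
def bierbrauerMul {F : Type*} [Field F] (q m n : ℕ) (v : F) (x y : F) : F :=
  y ^ q ^ n * x + y * x ^ q ^ n
    - v * (y ^ q ^ (m + n) * x ^ q ^ (3 * m) + y ^ q ^ (3 * m) * x ^ q ^ (m + n))

/-! Write `j` and `s` for the powers `q^m` and `q^n`. The arithmetic hypotheses force `n` even and
`m` odd. No zero divisors: if `x ⋆ y = 0` with `y ≠ 0`, put `z = x / y`. Since `v = j u / u`,
clearing denominators gives `w (z + s z) = j w (j³ z + j (s z))`, where `w` is `u` times a square,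
hence a nonsquare. If `D = z - j² z` is nonzero, this yields an identity between elements of the
field of order `q^(2m)` whose two sides have opposite quadratic characters (`exists_fixed_mul_eq`,
`eq_zero_of_twisted_eq`); if `D = 0`, then `z = 0` directly. Nuclei: both are read off from
coefficients, because distinct Frobenius powers are linearly independent. An identity `μ x ⋆ y = x ⋆
θ y` forces `μ` to be multiplication by some `c` fixed by the `2n`-th and `2m`-th Frobenius powers,
so `c ∈ 𝔽_{q²}` as `gcd(m, n) = 1` (`eq_mul_of_frobeniusForm_eq`). If scaling by `c` also factors
through the product, then `c ∈ 𝔽_q` (`frobenius_eq_of_sum_frobenius_frobeniusForm`). The nuclei of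
an isotopic semifield correspond to these scalars. -/

/-! ### Absence of zero divisors, by quadratic characters. -/

section ZeroDivisors

variable {F : Type*} [Field F]

/-- The linear equation behind a zero divisor, solved for the anti-invariant part of `z`. -/
theorem exists_fixed_mul_eq (j s : F →+* F) (hj : ∀ x, j (j (j (j x))) = x)
    (hjs : ∀ x, j (s x) = s (j x)) (w z : F) (hb : w - j (j w) ≠ 0)
    (h : w * (z + s z) = j w * (j (j (j z)) + j (s z))) :
    j ((w - j (j w)) * (z - j (j z))) = -((w - j (j w)) * (z - j (j z))) ∧
    ∃ f, j f = f ∧ 4 * (w * j (j w)) * ((z - j (j z)) * s (z - j (j z))) =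
      f * ((w - j (j w)) * (z - j (j z))) := by
  have e0 := h
  have e1 := congrArg j e0
  have e2 := congrArg j e1
  have e3 := congrArg j e2
  simp only [map_mul, map_add, hj] at e1 e2 e3
  have hb1 : j w - j (j (j w)) ≠ 0 := by
    rw [← map_sub]; exact (map_ne_zero j).2 hb
  -- With `X = w (z + s z)` and `Y = w (j² z + s z)` the hypothesis is `X = j Y`, so `X - Y = w D`,
  -- with `D = z - j² z`, has zero trace over the four powers of `j`. As `j² D = -D`, that trace is
  -- `c + j c` for `c = (w - j² w) D`.
  have hc : j ((w - j (j w)) * (z - j (j z))) = -((w - j (j w)) * (z - j (j z))) := by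
    simp only [map_mul, map_sub]
    linear_combination e0 + e1 + e2 + e3
  -- The witness comes from eliminating the alternating sum `V = X - j X - j² X + j³ X`: `hV` gives
  -- `V` in terms of `c`, and `hW` gives `4 w j²w · s D` in terms of `V` and the trace of `X`. It is
  -- fixed by `j` because `j c = -c` makes `D / j (w - j² w)` fixed.
  refine ⟨hc, (w + j (j w)) * j (w + j (j w)) * (z - j (j z)) / (j w - j (j (j w)))
    - (w * (z + s z) + j (w * (z + s z)) + j (j (w * (z + s z)))
      + j (j (j (w * (z + s z))))), ?_, ?_⟩
  · simp only [map_mul, map_sub, map_add, map_div₀, hj] at hc ⊢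
    have hb3 : j (j w) - w ≠ 0 := by rw [← neg_sub]; exact neg_ne_zero.2 hb
    have key : (j (j w) + w) * (j w + j (j (j w))) * (j z - j (j (j z))) / (j (j w) - w) =
        (w + j (j w)) * (j w + j (j (j w))) * (z - j (j z)) / (j w - j (j (j w))) := by
      rw [div_eq_div_iff hb3 hb1]
      linear_combination ((j (j w) + w) * (j w + j (j (j w)))) * hc
    linear_combination key
  · have hV : (j w - j (j (j w))) * (w * (z + s z) + j (j (j w)) * (j (j (j z)) + j (j (j (s z))))
        - j w * (j z + j (s z)) - j (j w) * (j (j z) + j (j (s z)))) =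
        (j w + j (j (j w))) * ((w - j (j w)) * (z - j (j z))) := by
      simp only [map_mul, map_sub] at hc
      linear_combination (j w - j (j (j w))) * (e0 - e2) - (j w + j (j (j w))) * hc
    have hW : 4 * (w * j (j w)) * (s z - j (j (s z))) =
        (j (j w) - w) * (w * (z + s z) + j (j (j w)) * (j (j (j z)) + j (j (j (s z))))
        + j w * (j z + j (s z)) + j (j w) * (j (j z) + j (j (s z)))) +
        (w + j (j w)) * (w * (z + s z) + j (j (j w)) * (j (j (j z)) + j (j (j (s z))))
        - j w * (j z + j (s z)) - j (j w) * (j (j z) + j (j (s z)))) := by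
      linear_combination (-2 * j (j w)) * e3 + 2 * w * e1
    simp only [map_mul, map_sub, map_add, ← hjs]
    have hq := div_mul_cancel₀ ((w + j (j w)) * (j w + j (j (j w))) * (z - j (j z))) hb1
    refine mul_right_cancel₀ hb1 ?_
    linear_combination (z - j (j z)) * (j w - j (j (j w))) * hW
      + (z - j (j z)) * (w + j (j w)) * hV - (w - j (j w)) * (z - j (j z)) * hq

/-- Let `Q = 4t + 1` and `e = (Q² - 1) / 2 = 4t(2t + 1)`; on the nonzero elements fixed by `j²`,
raising to the power `e` is the quadratic character. The hypothesis on `w` says that `w` is a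
nonsquare. If `D ≠ 0`, then in `4 (w j²w)(D s D) = f c` the factors `4` and `f`, fixed by `j`, have
character `1`, while `w j²w`, `D s D` and `c` each have character `-1`; the last two values use that
`4r + 1` and `Q` are `1` mod `4`. The sides then give `1 = -1`. -/
theorem eq_zero_of_twisted_eq (h2 : (2 : F) ≠ 0) (j s : F →+* F) (t r : ℕ)
    (hQ : ∀ x, j x = x ^ (4 * t + 1)) (hR : ∀ x, s x = x ^ (4 * r + 1))
    (hj : ∀ x, j (j (j (j x))) = x)
    (hfix : ∀ x, s (s x) = x → j (j x) = x → s x = x)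
    (w z : F) (hw : w ^ (((4 * t + 1) ^ 2 + 1) * (4 * t * (2 * t + 1))) = -1)
    (h : w * (z + s z) = j w * (j (j (j z)) + j (s z))) : z = 0 := by
  have hne : (1 : F) ≠ -1 := fun h => h2 (by linear_combination h)
  have hodd : ∀ k : ℕ, (-1 : F) ^ (2 * k + 1) = -1 := fun k => by rw [pow_succ, pow_mul]; simp
  have hw0 : w ≠ 0 := by
    rintro rfl
    by_cases ht : t = 0
    · subst ht; simp at hw; exact hne hw
    · rw [zero_pow (by positivity)] at hw
      exact one_ne_zero (neg_eq_zero.1 hw.symm)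
  have hjs : ∀ x, j (s x) = s (j x) := fun x => by simp only [hQ, hR, ← pow_mul, mul_comm]
  have hfixpow : ∀ f, f ≠ 0 → j f = f → f ^ (4 * t) = 1 := fun f hf h => by
    rw [hQ, pow_succ] at h
    exact mul_right_cancel₀ hf (by rw [h, one_mul])
  have hanti : ∀ f, f ≠ 0 → j f = -f → f ^ (4 * t) = -1 := fun f hf h => by
    rw [hQ, pow_succ] at h
    exact mul_right_cancel₀ hf (by rw [h, neg_one_mul])
  have hjj : ∀ f, j (j f) = f ^ (2 * (4 * t * (2 * t + 1))) * f := fun f => by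
    rw [hQ, hQ, ← pow_mul, ← pow_succ]; congr 1; ring
  have hwK : j (j w) ≠ w := fun h => by
    rw [hjj] at h
    have h1 : w ^ (2 * (4 * t * (2 * t + 1))) = 1 := mul_right_cancel₀ hw0 (by rw [h, one_mul])
    have : ((4 * t + 1) ^ 2 + 1) * (4 * t * (2 * t + 1)) =
      2 * (4 * t * (2 * t + 1)) * (8 * t ^ 2 + 4 * t + 1) := by ring
    rw [this, pow_mul, h1, one_pow] at hw
    exact hne hw
  have hb : w - j (j w) ≠ 0 := sub_ne_zero.2 hwK.symm
  -- If `z` is fixed by `j²`, then `w (z + s z)` is fixed by `j`, while `w` is not fixed by `j²`; so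
  -- `s z = -z`, and `hfix` turns this into `2 z = 0`.
  by_cases hD : z - j (j z) = 0
  · have hz : j (j z) = z := (sub_eq_zero.1 hD).symm
    have hT : j (j (z + s z)) = z + s z := by rw [map_add, map_add, hjs, hjs, hz]
    have hwT : w * (z + s z) = j (w * (z + s z)) := by
      rw [hz] at h
      rw [map_mul, map_add, h]
    have hjj' : j (j (w * (z + s z))) = w * (z + s z) := by rw [← hwT, ← hwT]
    rw [map_mul, map_mul, hT] at hjj'
    have hT0 : z + s z = 0 := by
      by_contra hT0
      exact hwK (mul_right_cancel₀ hT0 hjj')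
    have hsz : s z = -z := by linear_combination hT0
    have h3 := hfix z (by rw [hsz, map_neg, hsz, neg_neg]) hz
    have : (2 : F) * z = 0 := by linear_combination hT0 - h3
    exact (mul_eq_zero.1 this).resolve_left h2
  · exfalso
    obtain ⟨hc, f, hf, hfe⟩ := exists_fixed_mul_eq j s hj hjs w z hb h
    set D := z - j (j z) with hDdef
    set c := (w - j (j w)) * D
    have hc0 : c ≠ 0 := mul_ne_zero hb hD
    have h4 : (4 : F) ≠ 0 := by
      have : (4 : F) = 2 * 2 := by norm_num
      rw [this]; exact mul_ne_zero h2 h2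
    have hf0 : f ≠ 0 := by
      rintro rfl
      rw [zero_mul] at hfe
      refine absurd hfe (mul_ne_zero (mul_ne_zero h4 (mul_ne_zero hw0 ?_)) (mul_ne_zero hD ?_)) <;>
      simpa
    have hDD : j (j D) = -D := by simp only [hDdef, map_sub, hj, neg_sub]
    have hDp : D ^ (2 * (4 * t * (2 * t + 1))) = -1 := by
      rw [hjj] at hDD
      exact mul_right_cancel₀ hD (by rw [hDD, neg_one_mul])
    have hWp : (w * j (j w)) ^ (4 * t * (2 * t + 1)) = -1 := by
      rw [← hw, hQ, hQ, ← pow_mul, ← pow_succ', ← pow_mul]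
      congr 1; ring
    have hDs : (D * s D) ^ (4 * t * (2 * t + 1)) = -1 := by
      rw [hR, ← pow_succ', ← pow_mul]
      have : (4 * r + 1 + 1) * (4 * t * (2 * t + 1)) = 2 * (4 * t * (2 * t + 1)) * (2 * r + 1) := by
        ring
      rw [this, pow_mul, hDp, hodd]
    have hfp : f ^ (4 * t * (2 * t + 1)) = 1 := by rw [pow_mul, hfixpow f hf0 hf, one_pow]
    have h4p : (4 : F) ^ (4 * t * (2 * t + 1)) = 1 := by
      rw [pow_mul, hfixpow 4 h4 (map_ofNat j 4), one_pow]
    have hcp : c ^ (4 * t * (2 * t + 1)) = -1 := by rw [pow_mul, hanti c hc0 hc, hodd]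
    have := congrArg (· ^ (4 * t * (2 * t + 1))) hfe
    simp only [mul_pow _ (D * s D), mul_pow 4 (w * j (j w)), mul_pow f, h4p, hWp, hDs, hfp, hcp] at this
    exact hne (by linear_combination this)

end ZeroDivisors

/-! ### Comparison of Frobenius coefficients and the scalars of the middle nucleus. -/

section Coefficients

variable {F : Type*} [Field F] {d : ℕ} {χ : ZMod d → F →+* F}

theorem linearIndependent_frobenius (hinj : Function.Injective χ) :
    LinearIndependent F (fun i => (χ i : F → F)) :=
  (linearIndependent_monoidHom F F).comp (fun i => (χ i : F →* F)) fun _ _ h =>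
    hinj (RingHom.ext fun x => DFunLike.congr_fun h x)

/-- By Dedekind independence the coefficient of `χ i` is well defined on combinations of the `χ j`.
Extending it to all functions lets it be applied to identities involving maps not known to be
additive. -/
theorem exists_coefficient_functional (hinj : Function.Injective χ) :
    ∃ l : ZMod d → (F → F) →ₗ[F] F, ∀ i j, l i (χ j) = if j = i then 1 else 0 := by
  have hli := linearIndependent_frobenius hinj
  obtain ⟨g, hg⟩ := LinearMap.exists_leftInverse_of_injective
    (Finsupp.linearCombination F (fun i => (χ i : F → F))) (LinearMap.ker_eq_bot.2 hli)
  refine ⟨fun i => (Finsupp.lapply i) ∘ₗ g, fun i j => ?_⟩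
  have := LinearMap.congr_fun hg (Finsupp.single j 1)
  simp only [LinearMap.comp_apply, Finsupp.linearCombination_single, one_smul,
    LinearMap.id_apply] at this
  simp only [LinearMap.comp_apply, this, Finsupp.lapply_apply, Finsupp.single_apply]

/-- An additive map commuting with the scalars fixed by the Frobenius is a linearized polynomial. -/
theorem exists_eq_sum_frobenius [Finite F] [NeZero d] (hinj : Function.Injective χ)
    (k : Subfield F) (hk : ∀ i, ∀ c ∈ k, χ i c = c) (hcard : Nat.card F = Nat.card k ^ d)
    (ν : F → F) (hadd : ∀ x y, ν (x + y) = ν x + ν y) (hmul : ∀ c ∈ k, ∀ x, ν (c * x) = c * ν x) :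
    ∃ c : ZMod d → F, ∀ x, ν x = ∑ t, c t * χ t x := by
  let X : ZMod d → F →ₗ[k] F := fun i =>
    { toFun := χ i
      map_add' := map_add _
      map_smul' := fun c x => by
        simp [Subfield.smul_def, hk i c c.2] }
  have hli : LinearIndependent F X := by
    have : LinearIndependent F (LinearMap.ltoFun k F F F ∘ X) := linearIndependent_frobenius hinj
    exact this.of_comp _
  have hfin : Module.finrank k F = d := by
    have h1 : 1 < Nat.card k := Finite.one_lt_card
    rw [Module.natCard_eq_pow_finrank (K := k)] at hcard
    exact Nat.pow_right_injective h1 hcard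
  -- The `F`-dimension of `End_k(F)` is `[F : k] = d`, the number of independent maps `χ i`.
  have hspan := hli.span_eq_top_of_card_eq_finrank'
    (by rw [Module.finrank_linearMap_self, hfin, ZMod.card])
  let N : F →ₗ[k] F :=
    { toFun := ν
      map_add' := hadd
      map_smul' := fun c x => by simp [Subfield.smul_def, hmul c c.2] }
  have hN : N ∈ Submodule.span F (Set.range X) := hspan ▸ Submodule.mem_top
  obtain ⟨c, hc⟩ := (Submodule.mem_span_range_iff_exists_fun F).1 hN
  refine ⟨c, fun x => ?_⟩
  have := LinearMap.congr_fun hc x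
  simp only [LinearMap.sum_apply, LinearMap.smul_apply, smul_eq_mul] at this
  exact this.symm

theorem map_four_terms (l : (F → F) →ₗ[F] F) (v c₀ c₁ c₂ c₃ : F) (f₀ f₁ f₂ f₃ : F → F) :
    l (fun y => c₀ * f₀ y + c₁ * f₁ y - v * (c₂ * f₂ y + c₃ * f₃ y)) =
      c₀ * l f₀ + c₁ * l f₁ - v * (c₂ * l f₂ + c₃ * l f₃) := by
  have : (fun y => c₀ * f₀ y + c₁ * f₁ y - v * (c₂ * f₂ y + c₃ * f₃ y)) =
    c₀ • f₀ + c₁ • f₁ - v • (c₂ • f₂ + c₃ • f₃) := rfl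
  rw [this]
  simp only [map_add, map_sub, map_smul, smul_eq_mul]

/-- The Bierbrauer multiplication, with Frobenius powers indexed modulo the degree. -/
def frobeniusForm (χ : ZMod d → F →+* F) (a b : ZMod d) (v x y : F) : F :=
  x * χ a y + χ a x * χ 0 y - v * (χ (3 * b) x * χ (a + b) y + χ (a + b) x * χ (3 * b) y)

variable {a b : ZMod d} {v : F}

theorem frobeniusForm_comm (h0 : ∀ x, χ 0 x = x) (x y : F) :
    frobeniusForm χ a b v x y = frobeniusForm χ a b v y x := by
  simp only [frobeniusForm, h0]; ring

theorem map_frobeniusForm (l : (F → F) →ₗ[F] F) (x : F) (f : F → F) :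
    l (fun y => frobeniusForm χ a b v x (f y)) =
      x * l (fun y => χ a (f y)) + χ a x * l (fun y => χ 0 (f y))
      - v * (χ (3 * b) x * l (fun y => χ (a + b) (f y))
        + χ (a + b) x * l (fun y => χ (3 * b) (f y))) :=
  map_four_terms l v _ _ _ _ (fun y => χ a (f y)) _ _ _

/-- The index relations satisfied by the exponents of the Bierbrauer multiplication. -/
structure ExponentRelations (a b : ZMod d) (par : ZMod d →+* ZMod 2) : Prop where
  par_a : par a = 0
  par_b : par b = 1
  ha : a ≠ 0
  hb : 2 * b ≠ 0
  hb4 : 4 * b = 0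
  hab : 2 * a ≠ 2 * b
  edge : 2 * a = 0 → a = 2 * b

variable {par : ZMod d →+* ZMod 2}

/-- The `y`-coefficients at `χ a` and `χ 0` express both `μ` and `χ a ∘ μ` by the exponents `0, a,
3b, a + b`. Applying `χ a` to the first expression shifts these to `a, 2a, a + 3b, 2a + b`, of which
generically only `a` lies in the original list, so only the scalar term of `μ` survives. The
`x`-coefficients at `y = 1` then give the fixed-point conditions on `c`. -/
theorem eq_mul_of_frobeniusForm_eq (h0 : ∀ x, χ 0 x = x)
    (hadd : ∀ i j x, χ (i + j) x = χ i (χ j x)) (hinj : Function.Injective χ)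
    (H : ExponentRelations a b par) (h2 : (2 : F) ≠ 0) (hv : v ≠ 0) (μ θ : F → F)
    (h : ∀ x y, frobeniusForm χ a b v (μ x) y = frobeniusForm χ a b v x (θ y)) :
    ∃ c, χ (2 * a) c = c ∧ χ (2 * b) c = c ∧ ∀ x, μ x = c * x := by
  obtain ⟨pa, pb, ha, hb, hb4, hab, he⟩ := H
  obtain ⟨l, hl⟩ := exists_coefficient_functional hinj
  have hlC : ∀ i j c, l i (fun x => χ j (c * x)) = χ j c * if j = i then 1 else 0 := by
    intro i j c
    have : (fun x => χ j (c * x)) = χ j c • (χ j : F → F) := by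
      funext x; simp
    rw [this, map_smul, hl, smul_eq_mul]
  have hform : ∀ i c₀ c₁ c₂ c₃ e₀ e₁ e₂ e₃ w,
      l i (fun x => c₀ * χ e₀ x + c₁ * χ e₁ x - w * (c₂ * χ e₂ x + c₃ * χ e₃ x)) =
      c₀ * (if e₀ = i then 1 else 0) + c₁ * (if e₁ = i then 1 else 0)
      - w * (c₂ * (if e₂ = i then 1 else 0) + c₃ * (if e₃ = i then 1 else 0)) := by
    intro i c₀ c₁ c₂ c₃ e₀ e₁ e₂ e₃ w
    rw [map_four_terms (l i) w c₀ c₁ c₂ c₃ (χ e₀) (χ e₁) (χ e₂) (χ e₃), hl, hl, hl, hl]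
  have p3 : par 3 = 1 := map_ofNat par 3
  have odd : ∀ i j : ZMod d, par i ≠ par j → i ≠ j := fun i j h h' => h (congrArg par h')
  have E : ∀ i x, μ x * (if a = i then 1 else 0) + χ a (μ x) * (if 0 = i then 1 else 0)
      - v * (χ (3 * b) (μ x) * (if a + b = i then 1 else 0)
        + χ (a + b) (μ x) * (if 3 * b = i then 1 else 0)) =
      x * l i (fun y => χ a (θ y)) + χ a x * l i (fun y => χ 0 (θ y))
      - v * (χ (3 * b) x * l i (fun y => χ (a + b) (θ y))
        + χ (a + b) x * l i (fun y => χ (3 * b) (θ y))) := fun i x => by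
    have := congrArg (l i) (funext fun y => h x y)
    rwa [map_frobeniusForm, map_frobeniusForm, hl, hl, hl, hl] at this
  have o1 : a + b ≠ a := odd _ _ (by simp [pa, pb])
  have o2 : 3 * b ≠ a := odd _ _ (by simp [pa, pb, p3])
  have o3 : a + b ≠ 0 := odd _ _ (by simp [pa, pb])
  have o4 : 3 * b ≠ 0 := odd _ _ (by simp [pb, p3])
  obtain ⟨C₀, C₁, C₂, C₃, E1⟩ : ∃ C₀ C₁ C₂ C₃ : F, ∀ x,
      μ x = C₀ * x + C₁ * χ a x - v * (C₂ * χ (3 * b) x + C₃ * χ (a + b) x) := by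
    refine ⟨l a (fun y => χ a (θ y)), l a (fun y => χ 0 (θ y)), l a (fun y => χ (a + b) (θ y)),
      l a (fun y => χ (3 * b) (θ y)), fun x => ?_⟩
    have := E a x
    rw [if_pos rfl, if_neg ha.symm, if_neg o1, if_neg o2] at this
    linear_combination this
  obtain ⟨D₀, D₁, D₂, D₃, E2⟩ : ∃ D₀ D₁ D₂ D₃ : F, ∀ x,
      χ a (μ x) = D₀ * χ 0 x + D₁ * χ a x - v * (D₂ * χ (3 * b) x + D₃ * χ (a + b) x) := by
    refine ⟨l 0 (fun y => χ a (θ y)), l 0 (fun y => χ 0 (θ y)), l 0 (fun y => χ (a + b) (θ y)),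
      l 0 (fun y => χ (3 * b) (θ y)), fun x => ?_⟩
    have := E 0 x
    rw [if_pos rfl, if_neg ha, if_neg o3, if_neg o4] at this
    rw [h0]
    linear_combination this
  have E3 : ∀ i, χ a C₀ * (if a = i then 1 else 0) + χ a C₁ * (if a + a = i then 1 else 0)
      - χ a v * (χ a C₂ * (if a + 3 * b = i then 1 else 0)
        + χ a C₃ * (if a + (a + b) = i then 1 else 0)) =
      D₀ * (if 0 = i then 1 else 0) + D₁ * (if a = i then 1 else 0)
      - v * (D₂ * (if 3 * b = i then 1 else 0) + D₃ * (if a + b = i then 1 else 0)) := by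
    intro i
    rw [← hform, ← hform]
    congr 1
    funext x
    rw [← E2, E1]
    simp only [map_sub, map_add, map_mul, hadd]
  have hva : χ a v ≠ 0 := (map_ne_zero _).2 hv
  have hμ : ∃ c, ∀ x, μ x = c * x := by
    have n1 : ∀ i, par i = 1 → a ≠ i := fun i h => odd _ _ (by rw [pa, h]; decide)
    have n2 : ∀ i, par i = 1 → a + a ≠ i := fun i h => odd _ _ (by rw [map_add, pa, h]; decide)
    have n3 : ∀ i, par i = 1 → 0 ≠ i := fun i h => odd _ _ (by rw [map_zero, h]; decide)
    have q1 : par (a + 3 * b) = 1 := by simp [pa, pb, p3]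
    have q2 : par (a + (a + b)) = 1 := by simp [pa, pb]
    have E4 := E3 (a + 3 * b)
    rw [if_neg (n1 _ q1), if_neg (n2 _ q1), if_neg (n3 _ q1), if_pos rfl,
      if_neg (fun h => ha (by linear_combination -h) : 3 * b ≠ a + 3 * b),
      if_neg (fun h => hb (by linear_combination -h) : a + b ≠ a + 3 * b)] at E4
    -- When `a = 2b` one has `a + b = 3b` and `2a = 0`: two terms merge and the `χ a` coefficient of
    -- `μ` is no longer killed. The `y`-coefficient at `3b` disposes of it, since the merged terms
    -- give a factor `2 ≠ 0`.
    by_cases hedge : a = 2 * b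
    · rw [if_pos (by rw [hedge]; ring)] at E4
      have h23 : C₂ + C₃ = 0 := by
        have : χ a v * χ a (C₂ + C₃) = 0 := by rw [map_add]; linear_combination -E4
        exact (map_eq_zero (χ a)).1 ((mul_eq_zero.1 this).resolve_left hva)
      have hab' : a + b = 3 * b := by rw [hedge]; ring
      have E5 : ∀ x, μ x = C₀ * x + C₁ * χ a x := fun x => by
        rw [E1, hab']; linear_combination -v * χ (3 * b) x * h23
      obtain ⟨X₀, X₁, X₂, X₃, E6⟩ : ∃ X₀ X₁ X₂ X₃ : F, ∀ x,
          - (2 * v) * χ (3 * b) (μ x) =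
            X₀ * χ 0 x + X₁ * χ a x - v * (X₂ * χ (3 * b) x + X₃ * χ (a + b) x) := by
        refine ⟨l (3 * b) (fun y => χ a (θ y)), l (3 * b) (fun y => χ 0 (θ y)),
          l (3 * b) (fun y => χ (a + b) (θ y)),
          l (3 * b) (fun y => χ (3 * b) (θ y)), fun x => ?_⟩
        have := E (3 * b) x
        rw [if_neg o2.symm, if_neg o4.symm, if_pos rfl, hab', if_pos rfl] at this
        rw [h0, hab']
        linear_combination this
      have E7 : 0 * (if (0 : ZMod d) = 3 * b + a then (1 : F) else 0)
          + (- (2 * v) * χ (3 * b) C₁) * (if 3 * b + a = 3 * b + a then 1 else 0)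
          - (2 * v) * (χ (3 * b) C₀ * (if 3 * b = 3 * b + a then 1 else 0)
            + 0 * (if 3 * b = 3 * b + a then 1 else 0)) =
          X₀ * (if 0 = 3 * b + a then 1 else 0) + X₁ * (if a = 3 * b + a then 1 else 0)
          - v * (X₂ * (if 3 * b = 3 * b + a then 1 else 0)
            + X₃ * (if a + b = 3 * b + a then 1 else 0)) := by
        rw [← hform, ← hform]
        congr 1
        funext x
        rw [← E6, E5]
        simp only [map_add, map_mul, hadd]
        ring
      rw [add_comm] at q1
      rw [if_neg (n3 _ q1), if_pos rfl, if_neg (n1 _ q1),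
        if_neg (fun h => ha (by linear_combination -h) : 3 * b ≠ 3 * b + a),
        if_neg (fun h => hb (by linear_combination -h) : a + b ≠ 3 * b + a)] at E7
      have hC1 : C₁ = 0 := by
        have : 2 * v * χ (3 * b) C₁ = 0 := by linear_combination -E7
        simpa [hv, h2] using this
      exact ⟨C₀, fun x => by rw [E5, hC1]; ring⟩
    · have E5 := E3 (a + (a + b))
      have E6 := E3 (a + a)
      rw [if_neg (fun h => hedge (by linear_combination h) : a + (a + b) ≠ a + 3 * b)] at E4
      rw [if_neg (n1 _ q2), if_neg (n2 _ q2), if_neg (n3 _ q2), if_pos rfl,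
        if_neg (fun h => hedge (by linear_combination -h) : a + 3 * b ≠ a + (a + b)),
        if_neg (fun h => hab (by linear_combination -h) : 3 * b ≠ a + (a + b)),
        if_neg (fun h => ha (by linear_combination -h) : a + b ≠ a + (a + b))] at E5
      have q0 : par (a + a) = 0 := by simp [pa]
      rw [if_neg (fun h => ha (by linear_combination -h) : a ≠ a + a), if_pos rfl,
        if_neg (odd _ _ (by rw [q0, q1]; decide)), if_neg (odd _ _ (by rw [q0, q2]; decide)),
        if_neg (fun h => hedge (he (by linear_combination -h)) : 0 ≠ a + a),
        if_neg (odd _ _ (by simp [pa, pb, p3])), if_neg (odd _ _ (by simp [pa, pb]))] at E6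
      have hC1 : C₁ = 0 := by
        have : χ a C₁ = 0 := by linear_combination E6
        simpa using this
      have hC2 : C₂ = 0 := by
        have : χ a v * χ a C₂ = 0 := by linear_combination -E4
        simpa [hv] using this
      have hC3 : C₃ = 0 := by
        have : χ a v * χ a C₃ = 0 := by linear_combination -E5
        simpa [hv] using this
      exact ⟨C₀, fun x => by rw [E1, hC1, hC2, hC3]; ring⟩
  obtain ⟨c, hc⟩ := hμ
  have G : ∀ i y, y * (χ a c * if a = i then 1 else 0) + χ a y * (χ 0 c * if 0 = i then 1 else 0)
      - v * (χ (3 * b) y * (χ (a + b) c * if a + b = i then 1 else 0)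
        + χ (a + b) y * (χ (3 * b) c * if 3 * b = i then 1 else 0)) =
      θ y * (if a = i then 1 else 0) + χ a (θ y) * (if 0 = i then 1 else 0)
      - v * (χ (3 * b) (θ y) * (if a + b = i then 1 else 0)
        + χ (a + b) (θ y) * (if 3 * b = i then 1 else 0)) := fun i y => by
    have := congrArg (l i) (funext fun x => (frobeniusForm_comm h0 y (c * x)).trans
      ((hc x ▸ h x y : frobeniusForm χ a b v (c * x) y = frobeniusForm χ a b v x (θ y)).trans
        (frobeniusForm_comm h0 x (θ y))))
    rwa [map_frobeniusForm, map_frobeniusForm, hlC, hlC, hlC, hlC, hl, hl, hl, hl] at this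
  have G1 := G a 1
  have G2 := G 0 1
  have G3 := G (3 * b) 1
  rw [if_pos rfl, if_neg ha.symm, if_neg o1, if_neg o2] at G1
  rw [if_pos rfl, if_neg ha, if_neg o3, if_neg o4, h0, map_one] at G2
  have hθ : θ 1 = χ a c := by linear_combination -G1
  have hA : χ (2 * a) c = c := by
    rw [two_mul, hadd, ← hθ]; linear_combination -G2
  refine ⟨c, hA, ?_, hc⟩
  rw [if_neg o2.symm, if_neg o4.symm, if_pos rfl, hθ] at G3
  simp only [map_one] at G3
  by_cases hedge : a = 2 * b
  · have hab' : a + b = 3 * b := by rw [hedge]; ring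
    rw [hab', if_pos rfl] at G3
    have : 2 * v * χ (3 * b) (χ a c - c) = 0 := by rw [map_sub]; linear_combination G3
    rw [← hedge]
    exact sub_eq_zero.1 ((map_eq_zero (χ (3 * b))).1
      ((mul_eq_zero.1 this).resolve_left (mul_ne_zero h2 hv)))
  · rw [if_neg (fun h => hedge (by linear_combination h) : a + b ≠ 3 * b), ← hadd (a + b) a c,
      (by ring : a + b + a = b + 2 * a), hadd b (2 * a) c, hA] at G3
    have : v * χ b (χ (2 * b) c - c) = 0 := by
      rw [map_sub, ← hadd, (by ring : b + 2 * b = 3 * b)]; linear_combination -G3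
    exact sub_eq_zero.1 ((map_eq_zero (χ b)).1 ((mul_eq_zero.1 this).resolve_left hv))

end Coefficients

/-! ### The additional condition on scalars coming from the center. -/

section CenterScalars

variable {F : Type*} [Field F] {d : ℕ} {χ : ZMod d → F →+* F} {a b : ZMod d} {v : F}
  {par : ZMod d →+* ZMod 2}

/-- If scaling one argument by `c` amounts to a linearized polynomial after the multiplication,
then `c` is fixed by the odd Frobenius powers. -/
theorem frobenius_eq_of_sum_frobenius_frobeniusForm [NeZero d] (h0 : ∀ x, χ 0 x = x)
    (hadd : ∀ i j x, χ (i + j) x = χ i (χ j x)) (hinj : Function.Injective χ)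
    (H : ExponentRelations a b par) (h2 : (2 : F) ≠ 0) (hv : v ≠ 0) (c : F) (k : ZMod d → F)
    (h : ∀ x y, ∑ t, k t * χ t (frobeniusForm χ a b v x y) = frobeniusForm χ a b v (c * x) y) :
    χ (3 * b) c = c := by
  obtain ⟨pa, pb, ha, hb, hb4, hab, he⟩ := H
  obtain ⟨l, hl⟩ := exists_coefficient_functional hinj
  have p3 : par 3 = 1 := map_ofNat par 3
  have odd : ∀ i j : ZMod d, par (i - j) = 1 → i ≠ j := by
    rintro i _ h rfl
    simp at h
  have hform : ∀ i c₀ c₁ c₂ c₃ e₀ e₁ e₂ e₃ w,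
      l i (fun x => c₀ * χ e₀ x + c₁ * χ e₁ x - w * (c₂ * χ e₂ x + c₃ * χ e₃ x)) =
      c₀ * (if e₀ = i then 1 else 0) + c₁ * (if e₁ = i then 1 else 0)
      - w * (c₂ * (if e₂ = i then 1 else 0) + c₃ * (if e₃ = i then 1 else 0)) := by
    intro i c₀ c₁ c₂ c₃ e₀ e₁ e₂ e₃ w
    rw [map_four_terms (l i) w c₀ c₁ c₂ c₃ (χ e₀) (χ e₁) (χ e₂) (χ e₃), hl, hl, hl, hl]
  have hsum : ∀ i (f : ZMod d → F → F), l i (fun x => ∑ t, k t * f t x) = ∑ t, k t * l i (f t) := by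
    intro i f
    have : (fun x => ∑ t, k t * f t x) = ∑ t, k t • f t := by
      funext x; simp
    rw [this, map_sum]
    simp only [map_smul, smul_eq_mul]
  have E : ∀ i j, ∑ t, k t * ((if t + a = j then 1 else 0) * (if t = i then 1 else 0)
        + (if t = j then 1 else 0) * (if t + a = i then 1 else 0)
        - χ t v * ((if t + (a + b) = j then 1 else 0) * (if t + 3 * b = i then 1 else 0)
          + (if t + 3 * b = j then 1 else 0) * (if t + (a + b) = i then 1 else 0))) =
      c * (if a = j then 1 else 0) * (if 0 = i then 1 else 0)
      + χ a c * (if 0 = j then 1 else 0) * (if a = i then 1 else 0)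
      - v * (χ (3 * b) c * (if a + b = j then 1 else 0) * (if 3 * b = i then 1 else 0)
        + χ (a + b) c * (if 3 * b = j then 1 else 0) * (if a + b = i then 1 else 0)) := by
    intro i j
    have h1 : ∀ x, ∑ t, k t * ((if t + a = j then 1 else 0) * χ t x
        + (if t = j then 1 else 0) * χ (t + a) x
        - χ t v * ((if t + (a + b) = j then 1 else 0) * χ (t + 3 * b) x
          + (if t + 3 * b = j then 1 else 0) * χ (t + (a + b)) x)) =
        c * (if a = j then 1 else 0) * χ 0 x
        + χ a c * (if 0 = j then 1 else 0) * χ a x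
        - v * (χ (3 * b) c * (if a + b = j then 1 else 0) * χ (3 * b) x
        + χ (a + b) c * (if 3 * b = j then 1 else 0) * χ (a + b) x) := by
      intro x
      have := congrArg (l j) (funext fun y => h x y)
      rw [hsum] at this
      simp only [frobeniusForm, map_sub, map_add, map_mul, ← hadd, h0] at this
      have h3 := hform j (c * x) (χ a (c * x)) (χ (3 * b) (c * x)) (χ (a + b) (c * x))
        a 0 (a + b) (3 * b) v
      refine Eq.trans (Finset.sum_congr rfl fun t _ => ?_) (this.trans (h3.trans ?_))
      · rw [hform]; ring
      · simp only [h0, map_mul]; ring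
    have := congrArg (l i) (funext h1)
    rwa [hsum, hform, Finset.sum_congr rfl fun t _ => by rw [hform]] at this
  have hand : ∀ (P Q : Prop) [Decidable P] [Decidable Q],
      (if P then (1 : F) else 0) * (if Q then 1 else 0) = if P ∧ Q then 1 else 0 := by
    intro P Q _ _
    by_cases hP : P <;> by_cases hQ : Q <;> simp [hP, hQ]
  simp only [mul_assoc, hand] at E
  have n1 : ∀ t, (t + a = a ∧ t = 0) ↔ t = 0 := fun t => by simp
  have n2 : ∀ t, (t + (a + b) = a ∧ t + 3 * b = 0) ↔ False := fun t => by
    simp only [iff_false, not_and]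
    exact fun h h' => hb (by linear_combination h' - h)
  have n3 : ∀ t, (t + 3 * b = a ∧ t + (a + b) = 0) ↔ False := fun t => by
    simp only [iff_false, not_and]
    exact fun h h' => hab (by linear_combination h' - h)
  have n4 : ∀ t, (t + a = a + b ∧ t = 3 * b) ↔ False := fun t => by
    simp only [iff_false, not_and]
    exact fun h h' => hb (by linear_combination h - h')
  have n5 : ∀ t, (t = a + b ∧ t + a = 3 * b) ↔ False := fun t => by
    simp only [iff_false, not_and]
    exact fun h h' => hab (by linear_combination h' - h)
  have n6 : ∀ t, (t + (a + b) = a + b ∧ t + 3 * b = 3 * b) ↔ t = 0 := fun t => by simp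
  have z1 : a ≠ a + b := odd _ _ (by simp [pb])
  have z2 : 0 ≠ a + b := odd _ _ (by simp [pa, pb])
  have z3 : a + b ≠ a := odd _ _ (by simp [pb])
  have z4 : 3 * b ≠ a := odd _ _ (by simp [pa, pb, p3])
  -- Generically only `t = 0` contributes to the coefficients of `x · χ a y` and `χ (3b) x · χ (a +
  -- b) y`; they read `k 0 = c` and `v k 0 = v χ (3b) c`.
  have E1 := E 0 a
  have E2 := E (3 * b) (a + b)
  simp only [n1, n2, n3, ha, ha.symm, z3, z4, and_self, false_and, if_true, if_false, add_zero,
    mul_zero, mul_one, sub_zero] at E1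
  simp only [n4, n5, n6, z1, z2, and_self, false_and, if_true, if_false, add_zero,
    mul_zero, mul_one, zero_sub] at E2
  by_cases hedge : a = 2 * b
  · have m1 : ∀ t, (t = a ∧ t + a = 0) ↔ t = a := fun t =>
      ⟨And.left, fun h => ⟨h, by rw [h, hedge]; linear_combination hb4⟩⟩
    have hab' : a + b = 3 * b := by rw [hedge]; ring
    have E3 := E b b
    have m3 : ∀ t, (t + a = b ∧ t = b) ↔ False := fun t => by
      simp only [iff_false, not_and]
      exact fun h h' => ha (by linear_combination h - h')
    have m4 : ∀ t, (t = b ∧ t + a = b) ↔ False := fun t => by rw [and_comm, m3]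
    have m5 : ∀ t, (t + 3 * b = b) ↔ t = a := fun t =>
      ⟨fun h => by linear_combination h - hedge - hb4,
        fun h => by rw [h, hedge]; linear_combination hb4⟩
    have z5 : a ≠ b := odd _ _ (by simp [pa, pb])
    have z6 : 0 ≠ b := odd _ _ (by simp [pb])
    have z7 : 3 * b ≠ b := fun h => hb (by linear_combination h)
    simp only [hab', m3, m4, m5, z5, z6, z7, and_self, if_false, add_zero,
      mul_zero, zero_sub, sub_zero, mul_add, mul_neg, Finset.sum_neg_distrib,
      Finset.sum_add_distrib, mul_ite, mul_one, Finset.sum_ite_eq', Finset.mem_univ,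
      if_true] at E3
    simp only [m1, mul_add, mul_ite, mul_one, mul_zero, Finset.sum_add_distrib,
      Finset.sum_ite_eq', Finset.mem_univ, if_true] at E1
    simp only [hab', and_self, add_eq_right, mul_add, mul_neg, mul_ite, mul_one, mul_zero,
      Finset.sum_neg_distrib, Finset.sum_add_distrib,
      Finset.sum_ite_eq', Finset.mem_univ, if_true, h0] at E2
    -- For `a = 2b` the term `t = a` also enters `E1`; the coefficient at `(b, b)`, absent on the
    -- right, removes it.
    have hka : k a = 0 := by
      have : χ a v * 2 * k a = 0 := by linear_combination -E3
      simpa [hv, h2] using this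
    have : v * 2 * (χ (3 * b) c - c) = 0 := by linear_combination E2 + 2 * v * (E1 - hka)
    exact sub_eq_zero.1 ((mul_eq_zero.1 this).resolve_left (mul_ne_zero hv h2))
  · have h2a : 2 * a ≠ 0 := fun h => hedge (he h)
    have m1 : ∀ t, (t = a ∧ t + a = 0) ↔ False := fun t => by
      simp only [iff_false, not_and]
      exact fun h h' => h2a (by linear_combination h' - h)
    have m2 : ∀ t, (t + 3 * b = a + b ∧ t + (a + b) = 3 * b) ↔ False := fun t => by
      simp only [iff_false, not_and]
      exact fun h h' => h2a (by linear_combination h' - h + hb4)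
    have z5 : 3 * b ≠ a + b := fun h => hedge (by linear_combination -h)
    simp only [m1, if_false, add_zero, mul_ite, mul_one, mul_zero,
      Finset.sum_ite_eq', Finset.mem_univ, if_true] at E1
    simp only [m2, z5, false_and, if_false, add_zero, mul_neg, mul_ite, mul_one, mul_zero,
      Finset.sum_neg_distrib, Finset.sum_ite_eq', Finset.mem_univ, if_true, h0] at E2
    have : v * (χ (3 * b) c - c) = 0 := by linear_combination E2 + v * E1
    exact sub_eq_zero.1 ((mul_eq_zero.1 this).resolve_left hv)

end CenterScalars

/-! ### Transport of nuclei and center along an isotopism. -/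

section Isotopy

variable {F S : Type*} [Field F] [AddCommGroup S] {op : F → F → F} {mul : S → S → S}

/-- Through `g₁` and `g₂`, the identity `(a b) z = a (b z)` becomes `op (μ x) y = op x (θ y)`, with
`μ` and `θ` conjugate to right and left multiplication by `b`. Hence `μ` is a scalar `c`, and
evaluating at the identity `e` recovers `b`. -/
theorem middleNucleus_eq_image {e : S} (he : ∀ x, mul e x = x ∧ mul x e = x) (g₁ g₂ g₃ : F ≃+ S)
    (hg : ∀ x y, mul (g₁ x) (g₂ y) = g₃ (op x y)) {L : Subfield F}
    (hL : ∀ c ∈ L, ∀ x y, op (c * x) y = op x (c * y))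
    (hmax : ∀ μ θ : F → F, (∀ x y, op (μ x) y = op x (θ y)) → ∃ c ∈ L, ∀ x, μ x = c * x) :
    middleNucleus mul = (fun c => g₁ (c * g₁.symm e)) '' (L : Set F) := by
  ext b
  constructor
  · intro hb
    obtain ⟨c, hc, h⟩ := hmax (fun x => g₁.symm (mul (g₁ x) b))
      (fun y => g₂.symm (mul b (g₂ y))) fun x y => g₃.injective (by
        rw [← hg, ← hg, g₁.apply_symm_apply, g₂.apply_symm_apply]
        exact hb _ _)
    refine ⟨c, hc, ?_⟩
    simp only [← h, g₁.apply_symm_apply, (he b).1]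
  · rintro ⟨c, hc, rfl⟩ a z
    have h : ∀ x y, mul (g₁ (c * x)) (g₂ y) = mul (g₁ x) (g₂ (c * y)) := fun x y => by
      rw [hg, hg, hL c hc]
    have hl : ∀ y, mul (g₁ (c * g₁.symm e)) (g₂ y) = g₂ (c * y) := fun y => by
      rw [h, g₁.apply_symm_apply, (he _).1]
    have hm : ∀ x z, mul (g₁ (c * x)) z = mul (g₁ x) (mul (g₁ (c * g₁.symm e)) z) :=
      fun x z => by rw [← g₂.apply_symm_apply z, hl, h]
    have hr := hm (g₁.symm a) e
    rw [(he _).2, (he _).2, g₁.apply_symm_apply] at hr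
    simp only
    rw [← hr, hm, g₁.apply_symm_apply]

/-- For central `b`, left multiplication conjugated by `g₃` is a map `ν` as in `hkmax`, because `b
(x y) = (b x) y = (x b) y`. Conversely, for `c ∈ k`, scaling by `c` transported by `g₃` can be
pulled out of either factor, so its value at `e` is central. -/
theorem semifieldCenter_eq_image {e : S} (he : ∀ x, mul e x = x ∧ mul x e = x)
    (hadd : ∀ a b c, mul a (b + c) = mul a b + mul a c) (g₁ g₂ g₃ : F ≃+ S)
    (hg : ∀ x y, mul (g₁ x) (g₂ y) = g₃ (op x y)) {L k : Subfield F}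
    (hL : ∀ c ∈ L, ∀ x y, op (c * x) y = op x (c * y))
    (hmax : ∀ μ θ : F → F, (∀ x y, op (μ x) y = op x (θ y)) → ∃ c ∈ L, ∀ x, μ x = c * x)
    (hkL : k ≤ L) (hk : ∀ c ∈ k, ∀ x y, op (c * x) y = c * op x y)
    (hkmax : ∀ c ∈ L, ∀ ν : F →+ F, (∀ x y, ν (op x y) = op (c * x) y) → c ∈ k) :
    semifieldCenter mul = (fun c => g₁ (c * g₁.symm e)) '' (k : Set F) := by
  ext b
  constructor
  · rintro ⟨⟨⟨hbl, hbm⟩, -⟩, hcomm⟩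
    have hb := hbm
    obtain ⟨c, hc, h⟩ := hmax (fun x => g₁.symm (mul (g₁ x) b))
      (fun y => g₂.symm (mul b (g₂ y))) fun x y => g₃.injective (by
        rw [← hg, ← hg, g₁.apply_symm_apply, g₂.apply_symm_apply]
        exact hb _ _)
    refine ⟨c, hkmax c hc (AddMonoidHom.mk' (fun z => g₃.symm (mul b (g₃ z)))
      fun x y => by rw [map_add, hadd, map_add]) fun x y => ?_, ?_⟩
    · rw [AddMonoidHom.mk'_apply, ← hg, ← hbl, hcomm, ← h, ← g₃.apply_symm_apply (mul _ _)]
      simp only [g₃.apply_symm_apply]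
      rw [← g₃.symm_apply_apply (op _ _), ← hg, g₁.apply_symm_apply]
    · simp only [← h, g₁.apply_symm_apply, (he b).1]
  · rintro ⟨c, hc, rfl⟩
    set n : S → S := fun z => g₃ (c * g₃.symm z) with hn
    have h1 : ∀ x y, mul (g₁ (c * x)) (g₂ y) = n (mul (g₁ x) (g₂ y)) := fun x y => by
      simp only [hn, hg, g₃.symm_apply_apply, hk c hc]
    have h2 : ∀ x y, mul (g₁ x) (g₂ (c * y)) = n (mul (g₁ x) (g₂ y)) := fun x y => by
      rw [← h1, hg, hg, hL c (hkL hc)]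
    have n1 : ∀ x, g₁ (c * x) = n (g₁ x) := fun x => by
      have := h1 x (g₂.symm e)
      rwa [g₂.apply_symm_apply, (he _).2, (he _).2] at this
    have n2 : ∀ y, g₂ (c * y) = n (g₂ y) := fun y => by
      have := h2 (g₁.symm e) y
      rwa [g₁.apply_symm_apply, (he _).1, (he _).1] at this
    have m1 : ∀ a z, mul (n a) z = n (mul a z) := fun a z => by
      have := h1 (g₁.symm a) (g₂.symm z)
      rwa [n1, g₁.apply_symm_apply, g₂.apply_symm_apply] at this
    have m2 : ∀ a z, mul a (n z) = n (mul a z) := fun a z => by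
      have := h2 (g₁.symm a) (g₂.symm z)
      rwa [n2, g₁.apply_symm_apply, g₂.apply_symm_apply] at this
    have hb : g₁ (c * g₁.symm e) = n e := by rw [n1, g₁.apply_symm_apply]
    simp only [hb]
    refine ⟨⟨⟨fun a z => ?_, fun a z => ?_⟩, fun a z => ?_⟩, fun a => ?_⟩ <;>
      simp only [m1, m2, (he _).1, (he _).2]

theorem card_image_mul_unit {e : S} (he : e ≠ 0) (g₁ : F ≃+ S) (L : Subfield F) :
    Nat.card ((fun c => g₁ (c * g₁.symm e)) '' (L : Set F)) = Nat.card L := by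
  refine Nat.card_image_of_injective (fun c c' h => ?_) _
  exact mul_right_cancel₀ (by simpa using he) (g₁.injective h)

theorem IsSemifield.one_ne_zero (h : IsSemifield mul) {e : S} (he : ∀ x, mul e x = x) : e ≠ 0 := by
  rintro rfl
  have := h.nontrivial
  obtain ⟨x, hx⟩ := exists_ne (0 : S)
  have h0 := h.right_distrib 0 0 x
  rw [add_zero, he] at h0
  exact hx (by simpa using h0)

theorem isPresemifieldMiddleNucleus_scalarMaps {L : Subfield F}
    (hadd : ∀ x x' y, op (x + x') y = op x y + op x' y)
    (hL : ∀ c ∈ L, ∀ x y, op (c * x) y = op x (c * y))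
    (hmax : ∀ μ θ : F → F, (∀ x y, op (μ x) y = op x (θ y)) → ∃ c ∈ L, ∀ x, μ x = c * x) :
    IsPresemifieldMiddleNucleus op (scalarMaps L) := by
  have hinj : Function.Injective (Module.toAddMonoidEnd F F) := fun c c' h => by
    have : c * 1 = c' * 1 := DFunLike.congr_fun h (1 : F)
    simpa using this
  refine ⟨⟨?_, ?_⟩, ?_⟩
  · exact (L.toSubring.equivMapOfInjective _ hinj).symm.toMulEquiv.isField (Field.toIsField L)
  · rintro φ ⟨y, hy⟩ _ ⟨c, hc, rfl⟩
    refine ⟨c * y, fun x => ?_⟩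
    rw [← hL c hc, ← hy]
    rfl
  · rintro K ⟨-, hK⟩ μ hμ
    have : ∀ y, ∃ y', ∀ x, op (μ x) y = op x y' := fun y => by
      obtain ⟨y', h⟩ := hK (AddMonoidHom.mk' (fun x => op x y) fun a b => hadd a b y)
        ⟨y, fun x => rfl⟩ μ hμ
      exact ⟨y', h⟩
    choose θ hθ using this
    obtain ⟨c, hc, h⟩ := hmax μ θ fun x y => hθ y x
    refine ⟨c, hc, ?_⟩
    ext x
    exact (h x).symm

end Isotopy

/-! ### Frobenius powers and their fixed fields. -/

section FiniteFieldFrobenius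

variable {F : Type*} [Field F]

theorem pow_pow_eq_self_of_dvd {q i k : ℕ} {x : F} (h : x ^ q ^ i = x) (hik : i ∣ k) :
    x ^ q ^ k = x := by
  have h' : Function.IsPeriodicPt (fun x : F => x ^ q) i x := by
    rw [Function.IsPeriodicPt, Function.IsFixedPt, pow_iterate]; exact h
  have := h'.trans_dvd hik
  rwa [Function.IsPeriodicPt, Function.IsFixedPt, pow_iterate] at this

theorem pow_pow_gcd_eq_self {q i k : ℕ} {x : F} (h : x ^ q ^ i = x) (h' : x ^ q ^ k = x) :
    x ^ q ^ Nat.gcd i k = x := by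
  have h1 : Function.IsPeriodicPt (fun x : F => x ^ q) i x := by
    rw [Function.IsPeriodicPt, Function.IsFixedPt, pow_iterate]; exact h
  have h2 : Function.IsPeriodicPt (fun x : F => x ^ q) k x := by
    rw [Function.IsPeriodicPt, Function.IsFixedPt, pow_iterate]; exact h'
  have := h1.gcd h2
  rwa [Function.IsPeriodicPt, Function.IsFixedPt, pow_iterate] at this

theorem exists_frobenius_powers [Finite F] {q d : ℕ} (hq : IsPrimePow q) (hq3 : 3 ≤ q) (hd : 0 < d)
    (hF : Nat.card F = q ^ d) {u : F} (hu : IsPrimitiveRoot u (q ^ d - 1)) :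
    ∃ χ : ZMod d → F →+* F, (∀ (i : ℕ) (x : F), χ i x = x ^ q ^ i) ∧ Function.Injective χ := by
  have : NeZero d := ⟨hd.ne'⟩
  have := Fintype.ofFinite F
  obtain ⟨p, e, hp, he, rfl⟩ := hq
  have hpp : p.Prime := hp.nat_prime
  have : Fact p.Prime := ⟨hpp⟩
  rw [Nat.card_eq_fintype_card] at hF
  have : CharP F p := charP_of_card_eq_prime_pow (f := e * d) (by rw [hF, pow_mul])
  have hval : ∀ (i : ZMod d) (x : F), iterateFrobenius F p (e * i.val) x = x ^ (p ^ e) ^ i.val :=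
    fun i x => by rw [iterateFrobenius_def, pow_mul]
  refine ⟨fun i => iterateFrobenius F p (e * i.val), fun i x => ?_, fun i k h => ?_⟩
  · rw [hval, ZMod.val_natCast]
    conv_rhs => rw [← Nat.div_add_mod i d, pow_add, pow_mul, pow_mul, ← hF,
      FiniteField.pow_card_pow]
  · have h1 := DFunLike.congr_fun h u
    simp only [hval] at h1
    -- The exponents `q^i`, `i < d`, stay below the order `q^d - 1` of `u`, so the primitive element
    -- separates the powers; the bound uses `q ≥ 3`.
    have hlt : ∀ i : ZMod d, (p ^ e) ^ i.val < (p ^ e) ^ d - 1 := fun i => by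
      have h2 : (p ^ e) ^ i.val ≤ (p ^ e) ^ (d - 1) :=
        Nat.pow_le_pow_right (by omega) (by have := ZMod.val_lt i; omega)
      have h3 : (p ^ e) ^ d = (p ^ e) ^ (d - 1) * (p ^ e) := by
        rw [← pow_succ]; congr 1; omega
      have h4 : 1 ≤ (p ^ e) ^ (d - 1) := Nat.one_le_pow _ _ (by omega)
      have h5 : (p ^ e) ^ (d - 1) * 3 ≤ (p ^ e) ^ (d - 1) * (p ^ e) := Nat.mul_le_mul_left _ hq3
      omega
    exact ZMod.val_injective d (Nat.pow_right_injective (by omega) (hu.pow_inj (hlt i) (hlt k) h1))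

/-- The fixed elements are `0` and the `(q^r - 1)`-th roots of unity, and a power of `u` is a
primitive such root. -/
theorem card_fixed_pow {q r d : ℕ} (hq3 : 3 ≤ q) (hr : 0 < r) (hd : 0 < d) (hrd : r ∣ d)
    {u : F} (hu : IsPrimitiveRoot u (q ^ d - 1)) (L : Subfield F)
    (hL : ∀ x, x ∈ L ↔ x ^ q ^ r = x) : Nat.card L = q ^ r := by
  classical
  have h1 : ∀ k, 0 < k → 3 ≤ q ^ k := fun k hk => hq3.trans (Nat.le_self_pow hk.ne' q)
  have hr3 := h1 r hr
  have hd3 := h1 d hd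
  obtain ⟨a, ha⟩ : q ^ r - 1 ∣ q ^ d - 1 := by
    obtain ⟨k, rfl⟩ := hrd
    rw [pow_mul]
    simpa using Nat.sub_dvd_pow_sub_pow (q ^ r) 1 k
  have hz := hu.pow (by omega) (ha.trans (mul_comm _ _))
  have hset : (L : Set F) = ↑(insert 0 (Polynomial.nthRootsFinset (q ^ r - 1) (1 : F))) := by
    ext x
    rw [SetLike.mem_coe, hL, Finset.mem_coe, Finset.mem_insert,
      Polynomial.mem_nthRootsFinset (by omega)]
    by_cases hx : x = 0
    · subst hx; simp; omega
    · simp only [hx, false_or]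
      have : x ^ q ^ r = x ^ (q ^ r - 1) * x := by rw [← pow_succ]; congr 1; omega
      rw [this]
      constructor
      · intro h; exact mul_right_cancel₀ hx (by rw [h, one_mul])
      · intro h; rw [h, one_mul]
  have hcard : Nat.card L = (L : Set F).ncard := rfl
  rw [hcard, hset, Set.ncard_coe_finset, Finset.card_insert_of_notMem, hz.card_nthRootsFinset]
  · omega
  · rw [Polynomial.mem_nthRootsFinset (by omega), zero_pow (by omega)]
    exact zero_ne_one

end FiniteFieldFrobenius

/-! ### Specialization to the Bierbrauer multiplication and the main theorem. -/

section Bierbrauer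

variable {F : Type*} [Field F]

theorem even_odd_of_odd_div_gcd {m n : ℕ} (hmn : Nat.Coprime m n)
    (hodd : Odd (2 * m / Nat.gcd (2 * m) n)) : Even n ∧ Odd m := by
  have hn : Even n := by
    by_contra h
    have h2 : Nat.Coprime 2 n := (Nat.coprime_two_left).2 (Nat.not_even_iff_odd.1 h)
    have : Nat.gcd (2 * m) n = 1 := Nat.Coprime.mul_left h2 hmn
    rw [this, Nat.div_one] at hodd
    exact (Nat.not_odd_iff_even.2 (even_two_mul m)) hodd
  refine ⟨hn, ?_⟩
  by_contra h
  have := Nat.dvd_gcd (Nat.not_odd_iff_even.1 h).two_dvd hn.two_dvd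
  rw [hmn] at this
  omega

theorem exponentRelations {m n : ℕ} (hn : 0 < n) (hn4m : n < 4 * m)
    (he : Even n) (ho : Odd m) :
    ExponentRelations (n : ZMod (4 * m)) (m : ZMod (4 * m))
      (ZMod.castHom (Dvd.intro (2 * m) (by ring)) (ZMod 2)) := by
  have hm : 0 < m := by omega
  refine ⟨?_, ?_, ?_, ?_, ?_, ?_, ?_⟩
  · rw [map_natCast, ZMod.natCast_eq_zero_iff]; exact he.two_dvd
  · rw [map_natCast]; exact (ZMod.natCast_eq_one_iff_odd).2 ho
  · rw [Ne, ZMod.natCast_eq_zero_iff]; exact Nat.not_dvd_of_pos_of_lt hn hn4m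
  · have : (2 * (m : ZMod (4 * m))) = ((2 * m : ℕ) : ZMod (4 * m)) := by push_cast; rfl
    rw [Ne, this, ZMod.natCast_eq_zero_iff]; exact Nat.not_dvd_of_pos_of_lt (by omega) (by omega)
  · have : (4 * (m : ZMod (4 * m))) = ((4 * m : ℕ) : ZMod (4 * m)) := by push_cast; rfl
    rw [this, ZMod.natCast_self]
  · intro h
    have h' : ((2 * n - 2 * m : ℤ) : ZMod (4 * m)) = 0 := by push_cast; rw [h, sub_self]
    rw [ZMod.intCast_zmod_eq_zero_iff_dvd] at h'
    obtain ⟨k, hk⟩ := h'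
    have h2 : (n : ℤ) = m * (1 + 2 * k) := by push_cast at hk; linarith
    have : Odd (n : ℤ) := by
      rw [h2]
      exact ((Int.odd_coe_nat m).2 ho).mul ⟨k, by ring⟩
    exact (Nat.not_odd_iff_even.2 he) ((Int.odd_coe_nat n).1 this)
  · intro h
    have h' : ((2 * n : ℕ) : ZMod (4 * m)) = 0 := by push_cast; exact h
    rw [ZMod.natCast_eq_zero_iff] at h'
    obtain ⟨k, hk⟩ := h'
    have hk1 : k = 1 := by
      have h1 : k < 2 := by
        by_contra hk2
        have : 4 * m * 2 ≤ 4 * m * k := Nat.mul_le_mul_left _ (by omega)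
        omega
      have h0 : k ≠ 0 := by rintro rfl; omega
      omega
    subst hk1
    have : n = 2 * m := by omega
    rw [this]; push_cast; rfl

theorem bierbrauerMul_comm (q m n : ℕ) (v x y : F) :
    bierbrauerMul q m n v x y = bierbrauerMul q m n v y x := by
  simp only [bierbrauerMul]; ring

theorem bierbrauerMul_eq_frobeniusForm {q m n : ℕ} {χ : ZMod (4 * m) → F →+* F}
    (hχ : ∀ (i : ℕ) (x : F), χ i x = x ^ q ^ i) (v x y : F) :
    bierbrauerMul q m n v x y = frobeniusForm χ n m v x y := by
  have h0 : χ 0 y = y := by simpa using hχ 0 y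
  have h1 : (3 * (m : ZMod (4 * m))) = ((3 * m : ℕ) : ZMod (4 * m)) := by push_cast; rfl
  have h2 : ((n : ZMod (4 * m)) + m) = ((m + n : ℕ) : ZMod (4 * m)) := by push_cast; ring
  rw [frobeniusForm, h0, h1, h2]
  simp only [hχ, bierbrauerMul]
  ring

theorem bierbrauerMul_eq_zero [Finite F] {q m n : ℕ} (hq3 : 3 ≤ q) (hm : 0 < m)
    (he : Even n) (hmn : Nat.Coprime m n)
    (hqm : q ^ m ≡ 1 [MOD 4]) (hqn : q ^ n ≡ 1 [MOD 4]) (hF : Nat.card F = q ^ (4 * m))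
    (h2 : (2 : F) ≠ 0) {u : F} (hu : IsPrimitiveRoot u (q ^ (4 * m) - 1)) (j s : F →+* F)
    (hj : ∀ x, j x = x ^ q ^ m) (hs : ∀ x, s x = x ^ q ^ n) {x y : F}
    (h : bierbrauerMul q m n (u ^ (q ^ m - 1)) x y = 0) : x = 0 ∨ y = 0 := by
  have := Fintype.ofFinite F
  have hpow : ∀ x : F, x ^ q ^ (4 * m) = x := fun x => by
    rw [← hF, Nat.card_eq_fintype_card, FiniteField.pow_card]
  by_cases hy : y = 0
  · exact Or.inr hy
  left
  have hQ3 : 3 ≤ q ^ m := hq3.trans (Nat.le_self_pow hm.ne' q)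
  obtain ⟨t, ht⟩ : ∃ t, q ^ m = 4 * t + 1 := ⟨q ^ m / 4, by
    have : q ^ m % 4 = 1 := hqm
    omega⟩
  obtain ⟨r, hr⟩ : ∃ r, q ^ n = 4 * r + 1 := ⟨q ^ n / 4, by
    have : q ^ n % 4 = 1 := hqn
    omega⟩
  have htpos : 0 < t := by omega
  set M := ((4 * t + 1) ^ 2 + 1) * (4 * t * (2 * t + 1)) with hM
  have hN : q ^ (4 * m) = 2 * M + 1 := by
    rw [mul_comm, pow_mul, ht, hM]; ring
  rw [hN, Nat.add_sub_cancel] at hu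
  have hMpos : 0 < M := by positivity
  have huM : u ^ M = -1 := by
    have h1 : u ^ M * u ^ M = 1 := by rw [← pow_add, ← two_mul]; exact hu.pow_eq_one
    have h3 : u ^ M ≠ 1 := hu.pow_ne_one_of_pos_of_lt hMpos.ne' (by omega)
    exact (mul_self_eq_one_iff.1 h1).resolve_left h3
  have hyM : y ^ (2 * M) = 1 := by
    have := hpow y
    rw [hN, pow_succ] at this
    exact mul_right_cancel₀ hy (by rw [this, one_mul])
  have hj4 : ∀ x, j (j (j (j x))) = x := fun x => by
    simp only [hj, ← pow_mul]
    rw [← pow_add, ← pow_add, ← pow_add, (by ring : m + m + m + m = 4 * m), hpow]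
  have hz : x / y = 0 := by
    -- Multiplying by `u · j y · j² y` makes the two coefficients conjugate under `j`. The cofactor
    -- of `u` in `w` is `y` to the even power `q^n + 1 + q^m + q^(2m)`, so `w` is a nonsquare like
    -- `u`.
    refine eq_zero_of_twisted_eq h2 j s t r (fun x => by rw [hj, ht]) (fun x => by rw [hs, hr])
      hj4 ?_ (u * (s y * y * j y * j (j y))) (x / y) ?_ ?_
    · intro z h1 h3
      simp only [hj, hs, ← pow_mul, ← pow_add] at h1 h3 ⊢
      have := pow_pow_gcd_eq_self h1 h3
      rw [← two_mul, ← two_mul, Nat.gcd_mul_left, Nat.gcd_comm, hmn, mul_one] at this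
      exact pow_pow_eq_self_of_dvd this he.two_dvd
    · rw [← hM, mul_pow, huM]
      have : s y * y * j y * j (j y) = y ^ (2 * (2 * (r + 1 + 3 * t + 4 * t ^ 2))) := by
        rw [hs, hj, hj, ht, hr, ← pow_mul, ← pow_succ, ← pow_add, ← pow_add]
        congr 1; ring
      have hM' : 2 * (2 * (r + 1 + 3 * t + 4 * t ^ 2)) * M =
        2 * M * (2 * (r + 1 + 3 * t + 4 * t ^ 2)) := by ring
      rw [this, ← pow_mul, hM', pow_mul, hyM, one_pow, mul_one]
    · have huQ : u ^ (q ^ m - 1) * u = j u := by rw [hj, ← pow_succ]; congr 1; omega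
      have hx : x = x / y * y := (div_mul_cancel₀ x hy).symm
      set z := x / y
      have h3 : ∀ x, x ^ q ^ (3 * m) = j (j (j x)) := fun x => by
        simp only [hj, ← pow_mul, ← pow_add]; congr 2; ring
      have h4 : ∀ x, x ^ q ^ (m + n) = j (s x) := fun x => by
        simp only [hj, hs, ← pow_mul, ← pow_add]; congr 2; ring
      rw [bierbrauerMul, h3, h3, h4, h4, ← hs, ← hs, hx] at h
      simp only [map_mul] at h ⊢
      linear_combination (u * j y * j (j y)) * h + (j y * j (j y) * (j (s y) * j (j (j z))
        * j (j (j y)) + j (j (j y)) * j (s z) * j (s y))) * huQ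
  simpa [hy] using hz

end Bierbrauer

theorem mainTheorem2 (q m n : ℕ) (hq : IsPrimePow q) (hq_odd : Odd q)
    (hn : 0 < n) (hn4m : n < 4 * m) (hmn : Nat.Coprime m n)
    (hodd : Odd (2 * m / Nat.gcd (2 * m) n))
    (hqm : q ^ m ≡ 1 [MOD 4]) (hqn : q ^ n ≡ 1 [MOD 4])
    (F : Type*) [Field F] [Finite F] (hF : Nat.card F = q ^ (4 * m))
    (u : F) (hu : IsPrimitiveRoot u (q ^ (4 * m) - 1)) :
    IsPresemifield (bierbrauerMul q m n (u ^ (q ^ m - 1))) ∧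
    (∃ L : Subfield F, Nat.card L = q ^ 2 ∧
      IsPresemifieldMiddleNucleus (bierbrauerMul q m n (u ^ (q ^ m - 1))) (scalarMaps L)) ∧
    (∀ (S : Type*) [AddCommGroup S] (mul : S → S → S), IsSemifield mul →
      Isotopic (bierbrauerMul q m n (u ^ (q ^ m - 1))) mul →
        Nat.card (middleNucleus mul) = q ^ 2 ∧ Nat.card (semifieldCenter mul) = q) := by
  have hm : 0 < m := by omega
  have hd : 0 < 4 * m := by omega
  have : NeZero (4 * m) := ⟨hd.ne'⟩
  obtain ⟨he, ho⟩ := even_odd_of_odd_div_gcd hmn hodd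
  have hq3 : 3 ≤ q := by
    have := hq.one_lt
    obtain ⟨k, rfl⟩ := hq_odd
    omega
  have h2 : (2 : F) ≠ 0 := by
    have := Fintype.ofFinite F
    refine Ring.two_ne_zero fun h => ?_
    rw [FiniteField.even_card_iff_char_two, ← Nat.card_eq_fintype_card, hF,
      ← Nat.even_iff] at h
    exact (Nat.not_even_iff_odd.2 (hq_odd.pow)) h
  obtain ⟨χ, hχ, hinj⟩ := exists_frobenius_powers hq hq3 hd hF hu
  have hχ0 : ∀ x, χ 0 x = x := fun x => by simpa using hχ 0 x
  have hχval : ∀ i x, χ i x = x ^ q ^ i.val := fun i x => by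
    rw [← hχ, ZMod.natCast_zmod_val]
  have hχadd : ∀ i j x, χ (i + j) x = χ i (χ j x) := fun i j x => by
    rw [hχval i, hχval j, ← pow_mul, ← pow_add, ← hχ, Nat.cast_add, ZMod.natCast_zmod_val,
      ZMod.natCast_zmod_val, add_comm]
  have hE := exponentRelations hn hn4m he ho
  have hu0 : u ≠ 0 := by
    rintro rfl
    have h1 : 3 ≤ q ^ (4 * m) := hq3.trans (Nat.le_self_pow hd.ne' q)
    have := hu.pow_eq_one
    rw [zero_pow (by omega)] at this
    exact zero_ne_one this
  have hv0 : u ^ (q ^ m - 1) ≠ 0 := pow_ne_zero _ hu0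
  have hform := bierbrauerMul_eq_frobeniusForm (n := n) hχ (u ^ (q ^ m - 1))
  have hzero : ∀ x y : F, bierbrauerMul q m n (u ^ (q ^ m - 1)) x y = 0 → x = 0 ∨ y = 0 :=
    fun x y => bierbrauerMul_eq_zero hq3 hm he hmn hqm hqn hF h2 hu (χ m) (χ n) (hχ m) (hχ n)
  set op := bierbrauerMul q m n (u ^ (q ^ m - 1)) with hop
  have hcomm : ∀ x y, op x y = op y x := bierbrauerMul_comm q m n _
  have hadd : ∀ x x' y, op (x + x') y = op x y + op x' y := fun x x' y => by
    simp only [hform, frobeniusForm, map_add]; ring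
  let L : Subfield F := (χ 2).eqLocusField (RingHom.id F)
  let k : Subfield F := (χ 1).eqLocusField (RingHom.id F)
  have hmemL : ∀ x, x ∈ L ↔ x ^ q ^ 2 = x := fun x => by
    have := hχ 2 x
    rw [← this]; rfl
  have hmemk : ∀ x, x ∈ k ↔ x ^ q ^ 1 = x := fun x => by
    have := hχ 1 x
    rw [Nat.cast_one] at this
    rw [← this]; rfl
  have hcardL : Nat.card L = q ^ 2 :=
    card_fixed_pow hq3 two_pos hd (Dvd.intro (2 * m) (by ring)) hu L hmemL
  have hcardk : Nat.card k = q := by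
    simpa using card_fixed_pow hq3 one_pos hd (one_dvd _) hu k hmemk
  have hkL : k ≤ L := fun x hx =>
    (hmemL x).2 (pow_pow_eq_self_of_dvd ((hmemk x).1 hx) (one_dvd 2))
  have hkfix : ∀ c ∈ k, ∀ i : ℕ, c ^ q ^ i = c := fun c hc i =>
    pow_pow_eq_self_of_dvd ((hmemk c).1 hc) (one_dvd i)
  have hLodd : ∀ c ∈ L, ∀ i : ℕ, Odd i → c ^ q ^ i = c ^ q := by
    rintro c hc _ ⟨i, rfl⟩
    rw [pow_succ, pow_mul, pow_pow_eq_self_of_dvd ((hmemL c).1 hc) (dvd_mul_right 2 i)]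
  have hL : ∀ c ∈ L, ∀ x y, op (c * x) y = op x (c * y) := fun c hc x y => by
    simp only [hop, bierbrauerMul, mul_pow]
    rw [pow_pow_eq_self_of_dvd ((hmemL c).1 hc) he.two_dvd, hLodd c hc _ (ho.add_even he),
      hLodd c hc (3 * m) ((by decide : Odd 3).mul ho)]
    ring
  have hk : ∀ c ∈ k, ∀ x y, op (c * x) y = c * op x y := fun c hc x y => by
    simp only [hop, bierbrauerMul, mul_pow, hkfix c hc]
    ring
  have hmax : ∀ μ θ : F → F, (∀ x y, op (μ x) y = op x (θ y)) → ∃ c ∈ L, ∀ x, μ x = c * x := by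
    intro μ θ h
    simp only [hform] at h
    obtain ⟨c, h1, h3, hc⟩ := eq_mul_of_frobeniusForm_eq hχ0 hχadd hinj hE h2 hv0 μ θ h
    refine ⟨c, (hmemL c).2 ?_, hc⟩
    have e1 : (2 * (n : ZMod (4 * m))) = ((2 * n : ℕ) : ZMod (4 * m)) := by push_cast; rfl
    have e2 : (2 * (m : ZMod (4 * m))) = ((2 * m : ℕ) : ZMod (4 * m)) := by push_cast; rfl
    rw [e1, hχ] at h1
    rw [e2, hχ] at h3
    have := pow_pow_gcd_eq_self h3 h1
    rwa [Nat.gcd_mul_left, hmn, mul_one] at this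
  have hkmax : ∀ c ∈ L, ∀ ν : F →+ F, (∀ x y, ν (op x y) = op (c * x) y) → c ∈ k := by
    intro c hc ν hν
    -- Every element is a product, so `ν` inherits `k`-linearity from `op` and is therefore a
    -- linearized polynomial.
    have hsurj : ∀ z, ∃ x, op x 1 = z := by
      let R : F →+ F := AddMonoidHom.mk' (fun x => op x 1) fun x x' => hadd x x' 1
      have : Function.Injective R := (injective_iff_map_eq_zero R).2 fun x hx =>
        (hzero x 1 hx).resolve_right one_ne_zero
      exact Finite.injective_iff_surjective.1 this
    obtain ⟨w, hw⟩ := exists_eq_sum_frobenius hinj k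
      (fun i c hc => by rw [hχval, hkfix c hc]) (by rw [hcardk, hF]) ν (map_add ν) (by
        intro a ha z
        obtain ⟨x, rfl⟩ := hsurj z
        rw [← hk a ha, hν, hν, ← hk a ha]
        congr 1; ring)
    have h3 := frobenius_eq_of_sum_frobenius_frobeniusForm hχ0 hχadd hinj hE h2 hv0 c w
      fun x y => by rw [← hw, ← hform, ← hform, hν]
    have e : (3 * (m : ZMod (4 * m))) = ((3 * m : ℕ) : ZMod (4 * m)) := by push_cast; rfl
    -- On `𝔽_{q²}` every odd Frobenius power acts as `c ↦ c^q`, and `3m` is odd.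
    rw [e, hχ, hLodd c hc (3 * m) ((by decide : Odd 3).mul ho)] at h3
    exact (hmemk c).2 (by rwa [pow_one])
  refine ⟨⟨inferInstance, inferInstance, fun a b c => ?_, hadd, hzero⟩,
    ⟨L, hcardL, isPresemifieldMiddleNucleus_scalarMaps hadd hL hmax⟩, ?_⟩
  · rw [hcomm, hadd, hcomm b, hcomm c]
  · rintro S _ mul hS ⟨g₁, g₂, g₃, hg⟩
    obtain ⟨e, he'⟩ := hS.exists_one
    have he0 : e ≠ 0 := hS.one_ne_zero fun x => (he' x).1
    rw [middleNucleus_eq_image he' g₁ g₂ g₃ hg hL hmax,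
      semifieldCenter_eq_image he' hS.left_distrib g₁ g₂ g₃ hg hL hmax hkL hk hkmax,
      card_image_mul_unit he0, card_image_mul_unit he0]
    exact ⟨hcardL, hcardk⟩
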